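/- Let $\mu$ be the Thue–Morse morphism $0\mapsto 01$, $1\mapsto 10$ on binary words, and put $g(1)=\epsilon$, $g(2)=0$, $g(3)=1$, $g(4)=00$, $g(5)=11$. An infinite code $c_0c_1c_2\cdots\in\{1,2,3,4,5\}^\omega$ codes the infinite binary word $g(c_0)\,\mu(g(c_1))\,\mu^2(g(c_2))\cdots$, whenever this product is infinite. The exponent of a nonempty finite word is its length divided by its least period. An infinite word is $\frac73$-power-free if the supremum of the exponents of its finite nonempty factors is less than $\frac73$. An overlap is a word of the form $axaxa$ with $a$ a letter and $x$ a possibly empty word. **Theorem 8.** Every code in $212\{12,1112\}^\omega$ codes exactly one infinite binary word. Each infinite binary word coded by such a code is $\frac73$-power-free and contains arbitrarily large overlaps (for every $N$ it has a factor of length at least $N$ that is an overlap), and there are uncountably many words of this form. In particular, there are uncountably many infinite binary $\frac73$-power-free words, each containing arbitrarily large overlaps. -/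

import Mathlib

namespace BinaryWords

section Words

variable {α : Type*}

/-- The prefix relation between a finite word `u` and an infinite word `w`. -/
def IsPrefixOf (u : List α) (w : ℕ → α) : Prop :=
  ∀ (i : ℕ) (h : i < u.length), w i = u[i]

/-- The infinite word `w` is the infinite product `u 0 · u 1 · u 2 ⋯` of finite words:
all the partial products are prefixes of `w`, and their lengths are unbounded (so that
they determine all of `w`). -/
def IsInfiniteProduct (u : ℕ → List α) (w : ℕ → α) : Prop :=
  (∀ n, IsPrefixOf ((List.range n).flatMap u) w) ∧
    ∀ m : ℕ, ∃ n : ℕ, m ≤ ((List.range n).flatMap u).length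

/-- The finite word `u` is a factor (contiguous block) of the infinite word `w`. -/
def IsFactorOf (u : List α) (w : ℕ → α) : Prop :=
  ∃ k : ℕ, ∀ (i : ℕ) (h : i < u.length), w (k + i) = u[i]

/-- The least period of a (nonempty) word `u`, the least `p` with `1 ≤ p ≤ |u|` such that
`u[i] = u[i + p]` whenever both positions are in range. -/
noncomputable def per (u : List α) : ℕ :=
  sInf {p | 1 ≤ p ∧ p ≤ u.length ∧ u.HasPeriod p}

/-- The exponent `|u| / per u` of a nonempty word. -/
noncomputable def exponent (u : List α) : ℝ := (u.length : ℝ) / (per u : ℝ)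

/-- The critical exponent of an infinite word: the supremum, in the extended reals,
of the exponents of its finite nonempty factors. -/
noncomputable def criticalExponent (w : ℕ → α) : EReal :=
  ⨆ u ∈ {u : List α | u ≠ [] ∧ IsFactorOf u w}, (exponent u : EReal)

/-- An infinite word is `r`-power-free if its critical exponent is less than `r`. -/
def IsPowerFree (r : ℝ) (w : ℕ → α) : Prop := criticalExponent w < (r : EReal)

/-- An overlap is a word `a x a x a` with `a` a letter and `x` a possibly empty word. -/
def IsOverlap (u : List α) : Prop :=
  ∃ (a : α) (x : List α), u = [a] ++ x ++ [a] ++ x ++ [a]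

/-- The infinite word `w` contains arbitrarily large overlaps. -/
def HasLargeOverlaps (w : ℕ → α) : Prop :=
  ∀ N : ℕ, ∃ u : List α, IsOverlap u ∧ IsFactorOf u w ∧ N ≤ u.length

end Words

/-- The Thue-Morse morphism on letters: `0 ↦ 01`, `1 ↦ 10`. -/
def muLetter : Fin 2 → List (Fin 2)
  | 0 => [0, 1]
  | 1 => [1, 0]

/-- The Thue-Morse morphism on finite binary words. -/
def mu (u : List (Fin 2)) : List (Fin 2) := u.flatMap muLetter

/-- The code alphabet `{1, 2, 3, 4, 5}`. -/
inductive CodeLetter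
  | c1
  | c2
  | c3
  | c4
  | c5

open CodeLetter

/-- The binary words denoted by the code letters. -/
def g : CodeLetter → List (Fin 2)
  | c1 => []
  | c2 => [0]
  | c3 => [1]
  | c4 => [0, 0]
  | c5 => [1, 1]

/-- The infinite binary word `w` is coded by the infinite code `c`, that is,
`w = g(c 0) μ(g(c 1)) μ²(g(c 2)) ⋯`. -/
def IsCodedBy (w : ℕ → Fin 2) (c : ℕ → CodeLetter) : Prop :=
  IsInfiniteProduct (fun i => mu^[i] (g (c i))) w

/-- The set `212 {12, 1112}^ω` of infinite codes. -/
def overlapCodes : Set (ℕ → CodeLetter) :=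
  {c | ∃ b : ℕ → List CodeLetter, b 0 = [c2, c1, c2] ∧
    (∀ i, b (i + 1) = [c1, c2] ∨ b (i + 1) = [c1, c1, c1, c2]) ∧
    IsInfiniteProduct b c}

end BinaryWords

namespace BinaryWords

open CodeLetter

/-! ### Infinite products of finite words -/

section InfiniteProducts

variable {α : Type*}

/-! Such a code is the letter 2 followed by blocks 12 or 1112, so its word is w = 0μ²(v) or w =
0μ⁴(v), with v a word of the same kind. Everything is proved by induction along this recursion.

Powers: exponents are in fact at most 9/4 < 7/3. Repetitions inside a μ-image with even period
descend to the preimage; with odd period they are short (`MatchesOn.lt_of_odd`). Only repetitions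
using the prepended 0 could exceed 9/4. To control them, the induction on the period carries a
second claim: a prefix repetition of exponent exactly 9/4 has a period block ending in 1. Since μ²
of a letter ends in that letter, the new 0 cannot extend such a repetition (`prefix_consWord`).

Overlaps: every such v begins with 00, so μ²(v) or μ⁴(v) begins with a square whose root ends in 0;
prepending 0 gives an overlap. Applying μ² or μ⁴ at each outer level enlarges it.

Uncountability: a single letter of w reveals the first block, so the word determines the block
sequence. -/

theorem isPrefixOf_append {u v : List α} {w : ℕ → α} :
    IsPrefixOf (u ++ v) w ↔ IsPrefixOf u w ∧ IsPrefixOf v (fun i => w (i + u.length)) := by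
  constructor
  · intro h
    refine ⟨fun i hi => ?_, fun i hi => ?_⟩
    · rw [h i (by simp; omega), List.getElem_append_left hi]
    · have := h (i + u.length) (by simp; omega)
      simpa using this
  · rintro ⟨h₁, h₂⟩ i hi
    by_cases hu : i < u.length
    · rw [h₁ i hu, List.getElem_append_left hu]
    · push Not at hu
      obtain ⟨j, rfl⟩ := Nat.exists_eq_add_of_le' hu
      have := h₂ j (by simp at hi; omega)
      simpa using this

theorem isPrefixOf_nil (w : ℕ → α) : IsPrefixOf [] w := fun _ h => absurd h (by simp)

theorem isPrefixOf_cons {a : α} {u : List α} {w : ℕ → α} :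
    IsPrefixOf (a :: u) w ↔ w 0 = a ∧ IsPrefixOf u (fun i => w (i + 1)) := by
  rw [← List.singleton_append, isPrefixOf_append]
  refine and_congr_left fun _ => ⟨fun h => h 0 (by simp), fun h i hi => ?_⟩
  obtain rfl : i = 0 := by simpa using hi
  simpa using h

theorem flatMap_range_succ (u : ℕ → List α) (n : ℕ) :
    (List.range (n + 1)).flatMap u = u 0 ++ (List.range n).flatMap (fun i => u (i + 1)) := by
  simp [List.range_succ_eq_map, List.flatMap_map]

theorem length_flatMap_range_mono (u : ℕ → List α) :
    Monotone fun n => ((List.range n).flatMap u).length :=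
  monotone_nat_of_le_succ fun n => by simp [List.range_succ]

theorem isInfiniteProduct_iff {u : ℕ → List α} {w : ℕ → α} :
    IsInfiniteProduct u w ↔ IsPrefixOf (u 0) w ∧
      IsInfiniteProduct (fun i => u (i + 1)) (fun i => w (i + (u 0).length)) := by
  constructor
  · rintro ⟨h₁, h₂⟩
    have h := fun n => isPrefixOf_append.1 (flatMap_range_succ u n ▸ h₁ (n + 1))
    refine ⟨(h 0).1, fun n => (h n).2, fun m => ?_⟩
    obtain ⟨n, hn⟩ := h₂ (m + (u 0).length)
    refine ⟨n, ?_⟩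
    have := hn.trans (length_flatMap_range_mono u n.le_succ)
    simp only [Nat.succ_eq_add_one, flatMap_range_succ, List.length_append] at this
    omega
  · rintro ⟨h₀, h₁, h₂⟩
    refine ⟨fun n => ?_, fun m => ?_⟩
    · cases n with
      | zero => exact isPrefixOf_nil w
      | succ n => rw [flatMap_range_succ]; exact isPrefixOf_append.2 ⟨h₀, h₁ n⟩
    · obtain ⟨n, hn⟩ := h₂ m
      refine ⟨n + 1, ?_⟩
      rw [flatMap_range_succ, List.length_append]
      omega

theorem IsInfiniteProduct.unique {u : ℕ → List α} {w w' : ℕ → α}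
    (h : IsInfiniteProduct u w) (h' : IsInfiniteProduct u w') : w = w' := by
  funext i
  obtain ⟨n, hn⟩ := h.2 (i + 1)
  rw [h.1 n i hn, h'.1 n i hn]

theorem exists_isInfiniteProduct [Inhabited α] {u : ℕ → List α}
    (h : ∀ m : ℕ, ∃ n : ℕ, m ≤ ((List.range n).flatMap u).length) :
    ∃ w, IsInfiniteProduct u w := by
  -- `N i` factors already cover position `i`, which needs length at least `i + 1`.
  choose N hN using fun i => h (i + 1)
  have key : ∀ n n' i, n ≤ n' → ∀ (hi : i < ((List.range n).flatMap u).length)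
      (hi' : i < ((List.range n').flatMap u).length),
      ((List.range n).flatMap u)[i] = ((List.range n').flatMap u)[i] := by
    intro n n' i hnn hi hi'
    obtain ⟨d, rfl⟩ := Nat.exists_eq_add_of_le hnn
    simp only [List.range_add, List.flatMap_append]
    rw [List.getElem_append_left hi]
  refine ⟨fun i => ((List.range (N i)).flatMap u)[i]'(hN i), fun n i hi => ?_, h⟩
  rcases le_total n (N i) with hle | hle
  · exact (key _ _ i hle hi (hN i)).symm
  · exact key _ _ i hle (hN i) hi

end InfiniteProducts

/-! ### The Thue-Morse morphism on infinite words -/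

/-- The Thue-Morse morphism on infinite binary words. -/
def muInf (w : ℕ → Fin 2) (i : ℕ) : Fin 2 := if i % 2 = 0 then w (i / 2) else 1 - w (i / 2)

/-- Prepend a letter to an infinite word. -/
def consWord {α : Type*} (a : α) (w : ℕ → α) : ℕ → α
  | 0 => a
  | i + 1 => w i

@[simp] theorem consWord_zero {α : Type*} (a : α) (w : ℕ → α) : consWord a w 0 = a := rfl

@[simp] theorem consWord_succ {α : Type*} (a : α) (w : ℕ → α) (i : ℕ) :
    consWord a w (i + 1) = w i := rfl

@[simp] theorem muInf_even (w : ℕ → Fin 2) (i : ℕ) : muInf w (2 * i) = w i := by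
  simp [muInf]

@[simp] theorem muInf_odd (w : ℕ → Fin 2) (i : ℕ) : muInf w (2 * i + 1) = 1 - w i := by
  simp [muInf, Nat.add_mod, Nat.add_div]

theorem one_sub_ne_self : ∀ a : Fin 2, a ≠ 1 - a := by decide

theorem one_sub_inj : ∀ {a b : Fin 2}, 1 - a = 1 - b → a = b := by decide

theorem eq_of_ne_of_ne : ∀ {a b c : Fin 2}, a ≠ b → b ≠ c → a = c := by decide

theorem muInf_ne_succ (w : ℕ → Fin 2) {i : ℕ} (hi : i % 2 = 0) :
    muInf w i ≠ muInf w (i + 1) := by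
  obtain ⟨j, rfl⟩ : ∃ j, i = 2 * j := ⟨i / 2, by omega⟩
  simpa using one_sub_ne_self _

theorem muInf_injective : Function.Injective muInf := fun v w h =>
  funext fun i => by simpa using congrFun h (2 * i)

theorem length_mu (u : List (Fin 2)) : (mu u).length = 2 * u.length := by
  induction u with
  | nil => rfl
  | cons a u ih =>
    have : (muLetter a).length = 2 := by fin_cases a <;> rfl
    simp only [mu, List.flatMap_cons, List.length_append, List.length_cons] at ih ⊢
    omega

theorem muLetter_eq (a : Fin 2) : muLetter a = [a, 1 - a] := by fin_cases a <;> rfl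

theorem IsPrefixOf.mu {u : List (Fin 2)} {w : ℕ → Fin 2} (h : IsPrefixOf u w) :
    IsPrefixOf (mu u) (muInf w) := by
  induction u generalizing w with
  | nil => exact isPrefixOf_nil _
  | cons a u ih =>
    obtain ⟨h₀, h₁⟩ := isPrefixOf_cons.1 h
    have e : BinaryWords.mu (a :: u) = a :: (1 - a) :: BinaryWords.mu u := by
      simp [BinaryWords.mu, muLetter_eq]
    rw [e, isPrefixOf_cons, isPrefixOf_cons]
    refine ⟨by simpa [muInf] using h₀, by simp [muInf, h₀], ?_⟩
    convert ih h₁ using 1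
    funext i
    simp [muInf, add_assoc]

theorem flatMap_mu (u : ℕ → List (Fin 2)) (l : List ℕ) :
    l.flatMap (fun i => mu (u i)) = mu (l.flatMap u) := by
  simp only [mu, List.flatMap_assoc]

theorem IsInfiniteProduct.mu {u : ℕ → List (Fin 2)} {w : ℕ → Fin 2}
    (h : IsInfiniteProduct u w) : IsInfiniteProduct (fun i => mu (u i)) (muInf w) := by
  refine ⟨fun n => ?_, fun m => ?_⟩
  · rw [flatMap_mu]; exact (h.1 n).mu
  · obtain ⟨n, hn⟩ := h.2 m
    refine ⟨n, ?_⟩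
    rw [flatMap_mu, length_mu]
    omega

/-! ### Coded words -/

theorem IsCodedBy.cons_c1 {w : ℕ → Fin 2} {c : ℕ → CodeLetter} (hc : c 0 = c1)
    (h : IsCodedBy w (fun i => c (i + 1))) : IsCodedBy (muInf w) c := by
  refine isInfiniteProduct_iff.2 ⟨?_, ?_⟩
  · simpa [hc, g] using isPrefixOf_nil _
  · simpa [hc, g, Function.iterate_succ_apply'] using h.mu

theorem IsCodedBy.cons_c2 {w : ℕ → Fin 2} {c : ℕ → CodeLetter} (hc : c 0 = c2)
    (h : IsCodedBy w (fun i => c (i + 1))) : IsCodedBy (consWord 0 (muInf w)) c := by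
  refine isInfiniteProduct_iff.2 ⟨?_, ?_⟩
  · rw [hc]; exact isPrefixOf_cons.2 ⟨rfl, isPrefixOf_nil _⟩
  · simpa [hc, g, Function.iterate_succ_apply'] using h.mu

/-- The block `12` or `1112`. -/
def gapBlock : Bool → List CodeLetter
  | true => [c1, c2]
  | false => [c1, c1, c1, c2]

/-- The code `c` is `2` followed by the blocks `12` and `1112` in the order given by `s`. -/
def IsGapCode (s : ℕ → Bool) (c : ℕ → CodeLetter) : Prop :=
  c 0 = c2 ∧ IsInfiniteProduct (fun i => gapBlock (s i)) (fun i => c (i + 1))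

theorem IsGapCode.of_true {s : ℕ → Bool} {c : ℕ → CodeLetter} (h : IsGapCode s c)
    (hs : s 0 = true) : c 1 = c1 ∧ IsGapCode (fun i => s (i + 1)) (fun i => c (i + 2)) := by
  obtain ⟨_, h⟩ := h
  obtain ⟨h₁, h₂⟩ := isInfiniteProduct_iff.1 h
  simp only [hs, gapBlock, isPrefixOf_cons] at h₁
  simp only [hs, gapBlock] at h₂
  exact ⟨h₁.1, h₁.2.1, h₂⟩

theorem IsGapCode.of_false {s : ℕ → Bool} {c : ℕ → CodeLetter} (h : IsGapCode s c)
    (hs : s 0 = false) : c 1 = c1 ∧ c 2 = c1 ∧ c 3 = c1 ∧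
      IsGapCode (fun i => s (i + 1)) (fun i => c (i + 4)) := by
  obtain ⟨_, h⟩ := h
  obtain ⟨h₁, h₂⟩ := isInfiniteProduct_iff.1 h
  simp only [hs, gapBlock, isPrefixOf_cons] at h₁
  simp only [hs, gapBlock] at h₂
  exact ⟨h₁.1, h₁.2.1, h₁.2.2.1, h₁.2.2.2.1, h₂⟩

/-- The initial 212 is read as the letter 2 followed by a first block 12, which puts all blocks on
the same footing. -/
theorem mem_overlapCodes_iff {c : ℕ → CodeLetter} :
    c ∈ overlapCodes ↔ ∃ s, s 0 = true ∧ IsGapCode s c := by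
  classical
  constructor
  · rintro ⟨b, hb₀, hb, h⟩
    obtain ⟨h₁, h₂⟩ := isInfiniteProduct_iff.1 h
    simp only [hb₀, isPrefixOf_cons] at h₁
    simp only [hb₀] at h₂
    let s : ℕ → Bool := fun i => i.casesOn true fun j => decide (b (j + 1) = [c1, c2])
    have hs : ∀ i, b (i + 1) = gapBlock (s (i + 1)) := by
      intro i
      by_cases hi : b (i + 1) = [c1, c2]
      · simp [s, hi, gapBlock]
      · simp [s, gapBlock, (hb i).resolve_left hi]
    refine ⟨s, rfl, h₁.1, isInfiniteProduct_iff.2 ⟨?_, ?_⟩⟩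
    · exact isPrefixOf_cons.2 (h₁.2.imp_right isPrefixOf_cons.2)
    · simp only [hs] at h₂
      exact h₂
  · rintro ⟨s, hs, h⟩
    obtain ⟨h₁, h₂, h₃⟩ := h.of_true hs
    refine ⟨fun i => i.casesOn [c2, c1, c2] fun j => gapBlock (s (j + 1)), rfl, fun i => ?_,
      isInfiniteProduct_iff.2 ⟨?_, h₃⟩⟩
    · cases hi : s (i + 1) <;> simp [hi, gapBlock]
    · exact isPrefixOf_cons.2 ⟨h.1, isPrefixOf_cons.2 ⟨h₁, isPrefixOf_cons.2
        ⟨h₂, isPrefixOf_nil _⟩⟩⟩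

theorem exists_isGapCode (s : ℕ → Bool) : ∃ c, IsGapCode s c := by
  have : Inhabited CodeLetter := ⟨c1⟩
  have h : ∀ m, m ≤ ((List.range m).flatMap fun i => gapBlock (s i)).length := by
    intro m
    induction m with
    | zero => simp
    | succ m ih =>
      have : 1 ≤ (gapBlock (s m)).length := by cases s m <;> simp [gapBlock]
      simp only [List.range_succ, List.flatMap_append, List.length_append, List.flatMap_cons,
        List.flatMap_nil, List.append_nil]
      omega
  obtain ⟨c, hc⟩ := exists_isInfiniteProduct fun m => ⟨m, h m⟩
  exact ⟨consWord c2 c, rfl, hc⟩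

/-- The product of the first `n` words denoted by the letters of the code `c`. -/
def codePrefix (c : ℕ → CodeLetter) (n : ℕ) : List (Fin 2) :=
  (List.range n).flatMap fun i => mu^[i] (g (c i))

theorem codePrefix_succ (c : ℕ → CodeLetter) (n : ℕ) :
    codePrefix c (n + 1) = g (c 0) ++ mu (codePrefix (fun i => c (i + 1)) n) := by
  simp only [codePrefix, flatMap_range_succ, ← flatMap_mu, Function.iterate_succ_apply']
  rfl

theorem length_codePrefix_succ (c : ℕ → CodeLetter) (n : ℕ) :
    (codePrefix c (n + 1)).length =
      (g (c 0)).length + 2 * (codePrefix (fun i => c (i + 1)) n).length := by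
  rw [codePrefix_succ, List.length_append, length_mu]

/-- Each block ends in the code letter 2, which denotes a nonempty word, and μ never shortens; hence
the product is infinite. -/
theorem IsGapCode.exists_le_length {s : ℕ → Bool} {c : ℕ → CodeLetter} (h : IsGapCode s c)
    (m : ℕ) : ∃ n, m ≤ (codePrefix c n).length := by
  induction m generalizing s c with
  | zero => exact ⟨0, Nat.zero_le _⟩
  | succ m ih =>
    have h₀ : (g (c 0)).length = 1 := by rw [h.1]; rfl
    cases hs : s 0 with
    | true =>
      obtain ⟨n, hn⟩ := ih (h.of_true hs).2
      refine ⟨n + 2, ?_⟩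
      rw [length_codePrefix_succ, length_codePrefix_succ, h₀]
      simp only [add_assoc, Nat.reduceAdd]
      omega
    | false =>
      obtain ⟨n, hn⟩ := ih (h.of_false hs).2.2.2
      refine ⟨n + 4, ?_⟩
      rw [length_codePrefix_succ, length_codePrefix_succ, length_codePrefix_succ,
        length_codePrefix_succ, h₀]
      simp only [add_assoc, Nat.reduceAdd]
      omega

theorem IsGapCode.exists_isCodedBy {s : ℕ → Bool} {c : ℕ → CodeLetter} (h : IsGapCode s c) :
    ∃ w, IsCodedBy w c :=
  exists_isInfiniteProduct h.exists_le_length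

/-- The infinite word `w` is coded by the code with block sequence `s`. -/
def IsGapWord (s : ℕ → Bool) (w : ℕ → Fin 2) : Prop :=
  ∃ c, IsGapCode s c ∧ IsCodedBy w c

theorem exists_isGapWord (s : ℕ → Bool) : ∃ w, IsGapWord s w := by
  obtain ⟨c, hc⟩ := exists_isGapCode s
  obtain ⟨w, hw⟩ := hc.exists_isCodedBy
  exact ⟨w, c, hc, hw⟩

theorem IsGapWord.of_true {s : ℕ → Bool} {w : ℕ → Fin 2} (h : IsGapWord s w)
    (hs : s 0 = true) :
    ∃ v, IsGapWord (fun i => s (i + 1)) v ∧ w = consWord 0 (muInf (muInf v)) := by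
  obtain ⟨c, hc, hw⟩ := h
  obtain ⟨h₁, h₂⟩ := hc.of_true hs
  obtain ⟨v, hv⟩ := h₂.exists_isCodedBy
  exact ⟨v, ⟨_, h₂, hv⟩, hw.unique (IsCodedBy.cons_c2 hc.1 (.cons_c1 h₁ hv))⟩

theorem IsGapWord.of_false {s : ℕ → Bool} {w : ℕ → Fin 2} (h : IsGapWord s w)
    (hs : s 0 = false) :
    ∃ v, IsGapWord (fun i => s (i + 1)) v ∧
      w = consWord 0 (muInf (muInf (muInf (muInf v)))) := by
  obtain ⟨c, hc, hw⟩ := h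
  obtain ⟨h₁, h₂, h₃, h₄⟩ := hc.of_false hs
  obtain ⟨v, hv⟩ := h₄.exists_isCodedBy
  exact ⟨v, ⟨_, h₄, hv⟩,
    hw.unique (IsCodedBy.cons_c2 hc.1 (.cons_c1 h₁ (.cons_c1 h₂ (.cons_c1 h₃ hv))))⟩

theorem IsGapWord.zero {s : ℕ → Bool} {w : ℕ → Fin 2} (h : IsGapWord s w) : w 0 = 0 := by
  cases hs : s 0 with
  | true => obtain ⟨v, -, rfl⟩ := h.of_true hs; rfl
  | false => obtain ⟨v, -, rfl⟩ := h.of_false hs; rfl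

theorem IsGapWord.one {s : ℕ → Bool} {w : ℕ → Fin 2} (h : IsGapWord s w) : w 1 = 0 := by
  cases hs : s 0 with
  | true => obtain ⟨v, hv, rfl⟩ := h.of_true hs; simp [muInf, hv.zero]
  | false => obtain ⟨v, hv, rfl⟩ := h.of_false hs; simp [muInf, hv.zero]

/-- The two kinds of words begin with 0·0110·0110 and 0·0110·1001 respectively, and first differ at
position 5. -/
theorem IsGapWord.five {s : ℕ → Bool} {w : ℕ → Fin 2} (h : IsGapWord s w) :
    w 5 = if s 0 then 0 else 1 := by
  cases hs : s 0 with
  | true => obtain ⟨v, hv, rfl⟩ := h.of_true hs; simp [muInf, hv.one]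
  | false => obtain ⟨v, hv, rfl⟩ := h.of_false hs; simp [muInf, hv.zero]

theorem consWord_injective {α : Type*} (a : α) : Function.Injective (consWord a) := fun v w h =>
  funext fun i => by simpa using congrFun h (i + 1)

theorem IsGapWord.gaps_unique {s t : ℕ → Bool} {w : ℕ → Fin 2} (hs : IsGapWord s w)
    (ht : IsGapWord t w) : s = t := by
  funext n
  induction n generalizing s t w with
  | zero =>
    have := hs.five.symm.trans ht.five
    revert this
    cases s 0 <;> cases t 0 <;> simp
  | succ n ih =>
    have h := hs.five.symm.trans ht.five
    cases h₁ : s 0 <;> cases h₂ : t 0 <;> simp [h₁, h₂] at h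
    · obtain ⟨v, hv, rfl⟩ := hs.of_false h₁
      obtain ⟨v', hv', e⟩ := ht.of_false h₂
      have e := muInf_injective (muInf_injective (muInf_injective (muInf_injective
        (consWord_injective 0 e))))
      subst e
      exact ih hv hv'
    · obtain ⟨v, hv, rfl⟩ := hs.of_true h₁
      obtain ⟨v', hv', e⟩ := ht.of_true h₂
      have e := muInf_injective (muInf_injective (consWord_injective 0 e))
      subst e
      exact ih hv hv'

/-! ### Repetitions -/

/-- The word `w` agrees with its shift by `p` at the `m` positions from `k` on. -/
def MatchesOn (w : ℕ → Fin 2) (k p m : ℕ) : Prop :=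
  ∀ i, k ≤ i → i < k + m → w i = w (i + p)

/-- No letter occurs three times in a row. -/
def CubeFreeLetters (w : ℕ → Fin 2) : Prop :=
  ∀ i, w i = w (i + 1) → w (i + 1) ≠ w (i + 2)

theorem cubeFreeLetters_muInf (w : ℕ → Fin 2) : CubeFreeLetters (muInf w) := by
  intro i h₁ h₂
  rcases Nat.mod_two_eq_zero_or_one i with hi | hi
  · exact muInf_ne_succ w hi h₁
  · exact muInf_ne_succ w (i := i + 1) (by omega) h₂

/-- Either letter of a μ-block determines the block, so a partly covered block at either end still
gives a match in the preimage. -/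
theorem MatchesOn.of_muInf {w : ℕ → Fin 2} {k q m : ℕ} (h : MatchesOn (muInf w) k (2 * q) m) :
    ∃ n, m ≤ 2 * n ∧ MatchesOn w (k / 2) q n := by
  rcases m.eq_zero_or_pos with rfl | hm
  · exact ⟨0, le_rfl, fun j hj hj' => by omega⟩
  refine ⟨(k + m + 1) / 2 - k / 2, by omega, fun j hj hj' => ?_⟩
  by_cases hk : k ≤ 2 * j
  · have := h (2 * j) hk (by omega)
    rwa [← mul_add, muInf_even, muInf_even] at this
  · have := h (2 * j + 1) (by omega) (by omega)
    rw [show 2 * j + 1 + 2 * q = 2 * (j + q) + 1 by ring, muInf_odd, muInf_odd] at this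
    exact one_sub_inj this

/-- The two letters of a μ-block differ, and an odd shift carries a pair straddling two blocks onto
a single block. -/
theorem MatchesOn.alternates {w : ℕ → Fin 2} {k p m : ℕ} (h : MatchesOn (muInf w) k p m)
    (hp : p % 2 = 1) {i : ℕ} (hi : k ≤ i) (hi' : i + 1 < k + m) :
    muInf w i ≠ muInf w (i + 1) := by
  rcases Nat.mod_two_eq_zero_or_one i with h₂ | h₂
  · exact muInf_ne_succ w h₂
  · rw [h i hi (by omega), h (i + 1) (by omega) hi', add_right_comm]
    exact muInf_ne_succ w (by omega)

/-- Five alternating letters contain three equal ones at positions of the same parity, which come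
from three consecutive equal letters of `w`. -/
theorem MatchesOn.le_four {w : ℕ → Fin 2} (hw : CubeFreeLetters w) {k p m : ℕ}
    (h : MatchesOn (muInf w) k p m) (hp : p % 2 = 1) : m ≤ 4 := by
  by_contra! hm
  have e := fun (i : ℕ) (hi : i < 3) => eq_of_ne_of_ne (h.alternates hp (i := k + i) (by omega)
    (by omega)) (h.alternates hp (i := k + i + 1) (by omega) (by omega))
  have e₀ := e 0 (by omega)
  have e₁ := e 1 (by omega)
  have e₂ := e 2 (by omega)
  rcases Nat.mod_two_eq_zero_or_one k with hk | hk
  · obtain ⟨j, rfl⟩ : ∃ j, k = 2 * j := ⟨k / 2, by omega⟩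
    refine hw j ?_ ?_
    · rw [add_zero, show 2 * j + 1 + 1 = 2 * (j + 1) by ring] at e₀
      simpa using e₀
    · have := e₂
      rw [show 2 * j + 2 + 1 + 1 = 2 * (j + 2) by ring,
        show 2 * j + 2 = 2 * (j + 1) by ring] at this
      simpa using this
  · obtain ⟨j, rfl⟩ : ∃ j, k = 2 * j + 1 := ⟨k / 2, by omega⟩
    refine hw j ?_ ?_
    · rw [add_zero, show 2 * j + 1 + 1 + 1 = 2 * (j + 1) + 1 by ring] at e₀
      exact one_sub_inj (by simpa using e₀)
    · rw [show 2 * j + 1 + 2 + 1 + 1 = 2 * (j + 2) + 1 by ring,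
        show 2 * j + 1 + 2 = 2 * (j + 1) + 1 by ring] at e₂
      exact one_sub_inj (by simpa using e₂)

theorem MatchesOn.lt_of_odd {w : ℕ → Fin 2} (hw : CubeFreeLetters w) {k p m : ℕ}
    (h : MatchesOn (muInf w) k p m) (hp : p % 2 = 1) : 4 * m < 5 * p := by
  have h₄ := h.le_four hw hp
  by_contra! hm
  -- Since m ≤ 4, only these odd periods remain. Period 1 gives a cube of a letter; period 3
  -- contradicts alternation.
  obtain rfl | rfl : p = 1 ∨ p = 3 := by omega
  · exact cubeFreeLetters_muInf w k (h k le_rfl (by omega)) (h (k + 1) (by omega) (by omega))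
  · have a₀ := h.alternates hp (i := k) (by omega) (by omega)
    have a₁ := h.alternates hp (i := k + 1) (by omega) (by omega)
    have a₂ := h.alternates hp (i := k + 2) (by omega) (by omega)
    have := h k le_rfl (by omega)
    rw [eq_of_ne_of_ne a₀ a₁] at this
    exact a₂ this

/-- Repetitions of period `p` in `w` have exponent at most `9 / 4`. -/
def BoundedAt (w : ℕ → Fin 2) (p : ℕ) : Prop := ∀ k m, MatchesOn w k p m → 4 * m ≤ 5 * p

theorem boundedAt_muInf {w : ℕ → Fin 2} (hw : CubeFreeLetters w) {p : ℕ} (hp : 1 ≤ p)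
    (h : ∀ q, 1 ≤ q → 2 * q = p → BoundedAt w q) : BoundedAt (muInf w) p := by
  intro k m hm
  rcases Nat.mod_two_eq_zero_or_one p with hp₂ | hp₂
  · obtain ⟨q, rfl⟩ : ∃ q, p = 2 * q := ⟨p / 2, by omega⟩
    obtain ⟨n, hn, hq⟩ := hm.of_muInf
    have := h q (by omega) rfl _ _ hq
    omega
  · exact (hm.lt_of_odd hw hp₂).le

/-- If `w` begins with a repetition of period `p` and exponent exactly `9 / 4`, then the prefix
of length `p` ends in `1`. -/
def PrefixExtremalAt (w : ℕ → Fin 2) (p : ℕ) : Prop :=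
  ∀ m, MatchesOn w 0 p m → 4 * m = 5 * p → w (p - 1) = 1

/-- The image μ²(a) = aāāa ends in a, so last letters of period blocks survive μ². -/
theorem muInf_muInf_apply (w : ℕ → Fin 2) (i : ℕ) : muInf (muInf w) (4 * i + 3) = w i := by
  rw [show 4 * i + 3 = 2 * (2 * i + 1) + 1 by ring, muInf_odd, muInf_odd]
  exact sub_sub_cancel _ _

theorem MatchesOn.of_muInf_muInf {w : ℕ → Fin 2} {q m : ℕ}
    (h : MatchesOn (muInf (muInf w)) 0 (4 * q) m) : ∃ n, m ≤ 4 * n ∧ MatchesOn w 0 q n := by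
  rw [show 4 * q = 2 * (2 * q) by ring] at h
  obtain ⟨n, hn, h⟩ := h.of_muInf
  obtain ⟨n', hn', h⟩ := h.of_muInf
  exact ⟨n', by omega, h⟩

theorem prefixExtremalAt_muInf_muInf {w : ℕ → Fin 2} {p : ℕ} (hp : 1 ≤ p)
    (hb : ∀ q, 1 ≤ q → q < p → BoundedAt w q)
    (he : ∀ q, 1 ≤ q → q < p → PrefixExtremalAt w q) :
    PrefixExtremalAt (muInf (muInf w)) p := by
  intro m hm hmp
  -- Exponent exactly 9/4 forces 4 ∣ p.
  obtain ⟨q, rfl⟩ : ∃ q, p = 4 * q := ⟨p / 4, by omega⟩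
  obtain ⟨n, hn, h⟩ := hm.of_muInf_muInf
  have := hb q (by omega) (by omega) _ _ h
  rw [show 4 * q - 1 = 4 * (q - 1) + 3 by omega, muInf_muInf_apply]
  exact he q (by omega) (by omega) n h (by omega)

/-! ### Repetitions after prepending a letter -/

theorem MatchesOn.of_consWord {a : Fin 2} {w : ℕ → Fin 2} {k p m : ℕ}
    (h : MatchesOn (consWord a w) (k + 1) p m) : MatchesOn w k p m := fun i hi hi' => by
  simpa [add_right_comm] using h (i + 1) (by omega) (by omega)

theorem MatchesOn.of_consWord_zero {a : Fin 2} {w : ℕ → Fin 2} {p m : ℕ}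
    (h : MatchesOn (consWord a w) 0 p (m + 1)) : MatchesOn w 0 p m := fun i hi hi' => by
  simpa [add_right_comm] using h (i + 1) (by omega) (by omega)

/-- Prepending `0` to `μ² y` creates only repetitions of exponent at most `9 / 4` at the
beginning of the word, provided that `y` is suitable. -/
theorem prefix_consWord {y : ℕ → Fin 2} (hy₀ : y 0 = 0) (hy : CubeFreeLetters y) {p : ℕ}
    (hp : 1 ≤ p) (hb : ∀ q, 1 ≤ q → q < p → BoundedAt y q)
    (he : ∀ q, 1 ≤ q → q < p → PrefixExtremalAt y q)
    (ho : ∀ q m, q % 2 = 1 → MatchesOn y 0 q m → m ≤ 5) {m : ℕ}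
    (h : MatchesOn (consWord 0 (muInf (muInf y))) 0 p m) :
    4 * m ≤ 5 * p ∧ (4 * m = 5 * p → consWord 0 (muInf (muInf y)) (p - 1) = 1) := by
  rcases lt_or_ge (4 * m) (5 * p) with hlt | hge
  · exact ⟨hlt.le, fun h => absurd h hlt.ne⟩
  obtain ⟨m, rfl⟩ : ∃ n, m = n + 1 := ⟨m - 1, by omega⟩
  have hu := h.of_consWord_zero
  -- The prepended 0 must match the last letter of the period block in μ²(y).
  have hlast : muInf (muInf y) (p - 1) = 0 := by
    have := h 0 le_rfl (by omega)
    obtain ⟨r, rfl⟩ : ∃ r, p = r + 1 := ⟨p - 1, by omega⟩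
    rw [zero_add] at this
    exact this.symm
  rcases Nat.mod_two_eq_zero_or_one p with hp₂ | hp₂
  · obtain ⟨q, rfl⟩ : ∃ q, p = 2 * q := ⟨p / 2, by omega⟩
    rcases Nat.mod_two_eq_zero_or_one q with hq₂ | hq₂
    · obtain ⟨r, rfl⟩ : ∃ r, q = 2 * r := ⟨q / 2, by omega⟩
      rw [show 2 * (2 * r) = 4 * r by ring] at *
      obtain ⟨n, hn, hr⟩ := hu.of_muInf_muInf
      have h₁ := hb r (by omega) (by omega) _ _ hr
      rw [show 4 * r - 1 = 4 * (r - 1) + 3 by omega, muInf_muInf_apply] at hlast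
      have h₂ : 4 * n ≠ 5 * r := fun h₂ => by
        simp [he r (by omega) (by omega) n hr h₂] at hlast
      have h₃ := fun h => ho r n h hr
      -- Not being extremal, the match in y has 4n + 1 ≤ 5r, and `hge` forces equality. Then r is
      -- odd, so n ≤ 5, which leaves r = n = 1: the prefix 001100110.
      obtain rfl : r = 1 := by omega
      refine ⟨by omega, fun _ => ?_⟩
      simp [consWord, muInf, hy₀]
    · exfalso
      obtain ⟨n, hn, hq⟩ := hu.of_muInf
      have h₁ := hq.lt_of_odd hy hq₂
      have h₂ := hq.le_four hy hq₂
      -- The bounds force 4n + 1 = 5q with n ≤ 4 and q odd.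
      obtain rfl : q = 1 := by omega
      exact muInf_ne_succ y (i := 0) rfl (hq 0 le_rfl (by omega))
  · exfalso
    have h₀ : muInf (muInf y) 0 ≠ muInf (muInf y) 1 := muInf_ne_succ _ rfl
    by_cases hp₁ : p = 1
    · subst hp₁
      exact h₀ (hu 0 le_rfl (by omega))
    · refine hu.alternates hp₂ (i := 1) (by omega) (by omega) ?_
      simp [muInf]

theorem IsGapWord.cubeFreeLetters {s : ℕ → Bool} {w : ℕ → Fin 2} (h : IsGapWord s w) :
    CubeFreeLetters w := by
  have key : ∀ u : ℕ → Fin 2, CubeFreeLetters (consWord 0 (muInf u)) := by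
    intro u i h₁ h₂
    cases i with
    | zero => exact muInf_ne_succ u (i := 0) rfl h₂
    | succ i => exact cubeFreeLetters_muInf u i h₁ h₂
  cases hs : s 0 with
  | true => obtain ⟨v, -, rfl⟩ := h.of_true hs; exact key _
  | false => obtain ⟨v, -, rfl⟩ := h.of_false hs; exact key _

theorem IsGapWord.le_five {s : ℕ → Bool} {w : ℕ → Fin 2} (h : IsGapWord s w) (q m : ℕ)
    (hq : q % 2 = 1) (hm : MatchesOn w 0 q m) : m ≤ 5 := by
  have key : ∀ u : ℕ → Fin 2, w = consWord 0 (muInf (muInf u)) → m ≤ 5 := by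
    rintro u rfl
    rcases m with _ | m
    · omega
    · have := hm.of_consWord_zero.le_four (cubeFreeLetters_muInf u) hq
      omega
  cases hs : s 0 with
  | true => obtain ⟨v, -, e⟩ := h.of_true hs; exact key _ e
  | false => obtain ⟨v, -, e⟩ := h.of_false hs; exact key _ e

theorem IsGapWord.boundedAt_and_prefixExtremalAt {s : ℕ → Bool} {w : ℕ → Fin 2}
    (h : IsGapWord s w) {p : ℕ} (hp : 1 ≤ p) : BoundedAt w p ∧ PrefixExtremalAt w p := by
  induction p using Nat.strong_induction_on generalizing s w with
  | _ p ih =>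
  -- Applied with y = v for a block 12 and with y = μ²(v) for a block 1112.
  have combine : ∀ y : ℕ → Fin 2, y 0 = 0 → CubeFreeLetters y →
      (∀ q, 1 ≤ q → q < p → BoundedAt y q) → (∀ q, 1 ≤ q → q < p → PrefixExtremalAt y q) →
      (∀ q m, q % 2 = 1 → MatchesOn y 0 q m → m ≤ 5) →
      BoundedAt (consWord 0 (muInf (muInf y))) p ∧
        PrefixExtremalAt (consWord 0 (muInf (muInf y))) p := by
    intro y hy₀ hy hb he ho
    have H := fun m => prefix_consWord hy₀ hy hp hb he ho (m := m)
    refine ⟨fun k m hm => ?_, fun m hm => (H m hm).2⟩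
    cases k with
    | zero => exact (H m hm).1
    | succ k =>
      refine boundedAt_muInf (cubeFreeLetters_muInf y) hp (fun q hq hqp => ?_) k m hm.of_consWord
      exact boundedAt_muInf hy hq fun r hr _ => hb r hr (by omega)
  cases hs : s 0 with
  | true =>
    obtain ⟨v, hv, rfl⟩ := h.of_true hs
    exact combine v hv.zero hv.cubeFreeLetters (fun q hq hqp => (ih q hqp hv hq).1)
      (fun q hq hqp => (ih q hqp hv hq).2) hv.le_five
  | false =>
    obtain ⟨v, hv, rfl⟩ := h.of_false hs
    refine combine _ (by simp [muInf, hv.zero]) (cubeFreeLetters_muInf _)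
      (fun q hq hqp => ?_) (fun q hq hqp => ?_) (fun q m hq hm => ?_)
    · refine boundedAt_muInf (cubeFreeLetters_muInf v) hq fun r hr _ => ?_
      exact boundedAt_muInf hv.cubeFreeLetters hr fun t ht _ => (ih t (by omega) hv ht).1
    · exact prefixExtremalAt_muInf_muInf hq (fun r hr hrq => (ih r (by omega) hv hr).1)
        fun r hr hrq => (ih r (by omega) hv hr).2
    · exact (hm.le_four (cubeFreeLetters_muInf v) hq).trans (by omega)

/-! ### From least periods to the critical exponent -/

theorem per_spec {α : Type*} {u : List α} (hu : u ≠ []) :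
    1 ≤ per u ∧ per u ≤ u.length ∧ u.HasPeriod (per u) := by
  -- The length is always a period, so the `sInf` is attained and is not the default 0.
  have hne : {p | 1 ≤ p ∧ p ≤ u.length ∧ u.HasPeriod p}.Nonempty :=
    ⟨u.length, List.length_pos_iff.2 hu, le_rfl, by simp [List.HasPeriod]⟩
  exact Nat.sInf_mem hne

theorem IsFactorOf.matchesOn {u : List (Fin 2)} {w : ℕ → Fin 2} {p : ℕ} (h : IsFactorOf u w)
    (hp : u.HasPeriod p) : ∃ k, MatchesOn w k p (u.length - p) := by
  obtain ⟨k, hk⟩ := h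
  refine ⟨k, fun i hi hi' => ?_⟩
  obtain ⟨j, rfl⟩ := Nat.exists_eq_add_of_le hi
  have h₁ := hk j (by omega)
  have h₂ := hk (j + p) (by omega)
  rw [add_assoc, h₁, h₂]
  have := List.hasPeriod_iff_getElem?.1 hp j (by omega)
  simpa [List.getElem?_eq_getElem (show j < u.length by omega),
    List.getElem?_eq_getElem (show j + p < u.length by omega)] using this

theorem IsGapWord.isPowerFree {s : ℕ → Bool} {w : ℕ → Fin 2} (h : IsGapWord s w) :
    IsPowerFree (7 / 3 : ℝ) w := by
  have hle : criticalExponent w ≤ ((9 / 4 : ℝ) : EReal) := by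
    refine iSup₂_le fun u hu => EReal.coe_le_coe_iff.2 ?_
    obtain ⟨h₁, h₂, h₃⟩ := per_spec hu.1
    obtain ⟨k, hk⟩ := hu.2.matchesOn h₃
    have := (h.boundedAt_and_prefixExtremalAt h₁).1 _ _ hk
    have h₄ : 4 * u.length ≤ 9 * per u := by omega
    have h₅ : (0 : ℝ) < per u := by exact_mod_cast h₁
    rw [exponent, div_le_iff₀ h₅]
    have : (4 : ℝ) * u.length ≤ 9 * per u := by exact_mod_cast h₄
    linarith
  exact hle.trans_lt (EReal.coe_lt_coe_iff.2 (by norm_num))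

/-! ### Overlaps -/

theorem MatchesOn.muInf {w : ℕ → Fin 2} {k p m : ℕ} (h : MatchesOn w k p m) :
    MatchesOn (muInf w) (2 * k) (2 * p) (2 * m) := by
  intro i hi hi'
  have := h (i / 2) (by omega) (by omega)
  simp only [BinaryWords.muInf, show (i + 2 * p) % 2 = i % 2 by omega,
    show (i + 2 * p) / 2 = i / 2 + p by omega, this]

theorem MatchesOn.mono {w : ℕ → Fin 2} {k p m n : ℕ} (h : MatchesOn w k p m) (hn : n ≤ m) :
    MatchesOn w k p n := fun i hi hi' => h i hi (by omega)

theorem MatchesOn.consWord_zero {w : ℕ → Fin 2} {p m : ℕ} {a : Fin 2}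
    (h : MatchesOn w 0 (p + 1) m) (ha : w p = a) :
    MatchesOn (consWord a w) 0 (p + 1) (m + 1) := by
  intro i _ hi
  cases i with
  | zero => rw [zero_add]; exact ha.symm
  | succ i => rw [add_right_comm]; exact h i (Nat.zero_le i) (by omega)

theorem MatchesOn.consWord {w : ℕ → Fin 2} {k p m : ℕ} (h : MatchesOn w k p m) (a : Fin 2) :
    MatchesOn (consWord a w) (k + 1) p m := by
  intro i hi hi'
  obtain ⟨j, rfl⟩ : ∃ j, i = j + 1 := ⟨i - 1, by omega⟩
  rw [add_right_comm]
  exact h j (by omega) (by omega)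

theorem MatchesOn.exists_isOverlap {w : ℕ → Fin 2} {k p : ℕ} (hp : 1 ≤ p)
    (h : MatchesOn w k p (p + 1)) :
    ∃ u : List (Fin 2), IsOverlap u ∧ IsFactorOf u w ∧ p ≤ u.length := by
  -- In the overlap axaxa, of length 2p + 1, the word x has length q.
  obtain ⟨q, rfl⟩ : ∃ q, p = q + 1 := ⟨p - 1, by omega⟩
  refine ⟨(List.range (1 + q + 1 + q + 1)).map fun i => w (k + i),
    ⟨w k, (List.range q).map fun i => w (k + (1 + i)), ?_⟩, ⟨k, by simp⟩, by simp⟩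
  have h₁ := h k le_rfl (by omega)
  have h₂ := h (k + (q + 1)) (by omega) (by omega)
  have h₃ : ∀ i ∈ List.range q, w (k + (1 + q + 1 + i)) = w (k + (1 + i)) := fun i hi => by
    rw [h (k + (1 + i)) (by omega) (by simp at hi; omega)]
    congr 1; ring
  simp only [List.range_add, List.map_append, List.map_map, List.range_one, List.map_cons,
    List.map_nil, add_zero, Function.comp_def]
  rw [List.map_congr_left h₃, show k + (1 + q) = k + (q + 1) by ring, ← h₁,
    show k + (1 + q + 1 + q) = k + (q + 1) + (q + 1) by ring, ← h₂, ← h₁]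

theorem IsGapWord.exists_overlap {s : ℕ → Bool} {w : ℕ → Fin 2} (h : IsGapWord s w) (n : ℕ) :
    ∃ k p, n + 1 ≤ p ∧ MatchesOn w k p (p + 1) := by
  induction n generalizing s w with
  | zero =>
    -- The square 00 beginning v is inflated to one of period 4 or 16, whose root ends in 0; the
    -- prepended 0 completes the overlap.
    have key : ∀ {v : ℕ → Fin 2} {t}, IsGapWord t v → MatchesOn v 0 1 1 := by
      intro v t hv i hi hi'
      obtain rfl : i = 0 := by omega
      rw [hv.zero, zero_add, hv.one]
    cases hs : s 0 with
    | true =>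
      obtain ⟨v, hv, rfl⟩ := h.of_true hs
      exact ⟨0, 4, by omega,
        MatchesOn.consWord_zero (key hv).muInf.muInf (by simp [muInf, hv.zero])⟩
    | false =>
      obtain ⟨v, hv, rfl⟩ := h.of_false hs
      exact ⟨0, 16, by omega, MatchesOn.consWord_zero (key hv).muInf.muInf.muInf.muInf
        (by simp [muInf, hv.zero])⟩
  | succ n ih =>
    cases hs : s 0 with
    | true =>
      obtain ⟨v, hv, rfl⟩ := h.of_true hs
      obtain ⟨k, p, hp, hm⟩ := ih hv
      exact ⟨_, 2 * (2 * p), by omega, (hm.muInf.muInf.consWord 0).mono (by omega)⟩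
    | false =>
      obtain ⟨v, hv, rfl⟩ := h.of_false hs
      obtain ⟨k, p, hp, hm⟩ := ih hv
      exact ⟨_, 2 * (2 * (2 * (2 * p))), by omega,
        (hm.muInf.muInf.muInf.muInf.consWord 0).mono (by omega)⟩

theorem IsGapWord.hasLargeOverlaps {s : ℕ → Bool} {w : ℕ → Fin 2} (h : IsGapWord s w) :
    HasLargeOverlaps w := by
  intro N
  obtain ⟨k, p, hp, hm⟩ := h.exists_overlap N
  obtain ⟨u, hu, hw, hl⟩ := hm.exists_isOverlap (by omega)
  exact ⟨u, hu, hw, by omega⟩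

/-! ### Uncountability -/

theorem not_countable_gapWords :
    ¬ {w : ℕ → Fin 2 | ∃ s, s 0 = true ∧ IsGapWord s w}.Countable := by
  classical
  intro hc
  -- The blocks after the forced first one encode an arbitrary subset of ℕ; Cantor's theorem then
  -- applies.
  choose f hf using fun A : Set ℕ => exists_isGapWord (consWord true fun i => decide (i ∈ A))
  have hinj : Function.Injective f := fun A B hAB => by
    have h := hf B
    rw [← hAB] at h
    have := consWord_injective true ((hf A).gaps_unique h)
    ext i
    simpa using congrFun this i
  obtain ⟨e, he⟩ := Set.countable_iff_exists_injOn.1 hc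
  refine Function.cantor_injective (e ∘ f) fun A B hAB => hinj (he ?_ ?_ hAB)
  · exact ⟨_, rfl, hf A⟩
  · exact ⟨_, rfl, hf B⟩

theorem setOf_codedBy_overlapCodes :
    {w : ℕ → Fin 2 | ∃ c ∈ overlapCodes, IsCodedBy w c} =
      {w | ∃ s, s 0 = true ∧ IsGapWord s w} := by
  ext w
  simp only [mem_overlapCodes_iff, IsGapWord, Set.mem_ofPred_eq]
  constructor
  · rintro ⟨c, ⟨s, hs, hc⟩, hw⟩
    exact ⟨s, hs, c, hc, hw⟩
  · rintro ⟨s, hs, c, hc, hw⟩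
    exact ⟨c, ⟨s, hs, hc⟩, hw⟩

end BinaryWords

theorem theorem8 :
    -- every code in `212 {12, 1112}^ω` codes exactly one infinite binary word
    (∀ c ∈ BinaryWords.overlapCodes, ∃! w : ℕ → Fin 2, BinaryWords.IsCodedBy w c) ∧
    -- which is `7/3`-power-free and contains arbitrarily large overlaps
    (∀ c ∈ BinaryWords.overlapCodes, ∀ w : ℕ → Fin 2, BinaryWords.IsCodedBy w c →
      BinaryWords.IsPowerFree (7 / 3 : ℝ) w ∧ BinaryWords.HasLargeOverlaps w) ∧
    -- there are uncountably many words of this form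
    ¬ {w : ℕ → Fin 2 | ∃ c ∈ BinaryWords.overlapCodes, BinaryWords.IsCodedBy w c}.Countable ∧
    -- in particular, uncountably many infinite binary words have the two properties
    ¬ {w : ℕ → Fin 2 | BinaryWords.IsPowerFree (7 / 3 : ℝ) w ∧
        BinaryWords.HasLargeOverlaps w}.Countable := by
  have key : ∀ c ∈ BinaryWords.overlapCodes, ∀ w, BinaryWords.IsCodedBy w c →
      BinaryWords.IsPowerFree (7 / 3 : ℝ) w ∧ BinaryWords.HasLargeOverlaps w := by
    intro c hc w hw
    obtain ⟨s, -, hs⟩ := BinaryWords.mem_overlapCodes_iff.1 hc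
    have h : BinaryWords.IsGapWord s w := ⟨c, hs, hw⟩
    exact ⟨h.isPowerFree, h.hasLargeOverlaps⟩
  have hunc : ¬ {w : ℕ → Fin 2 | ∃ c ∈ BinaryWords.overlapCodes,
      BinaryWords.IsCodedBy w c}.Countable := by
    rw [BinaryWords.setOf_codedBy_overlapCodes]
    exact BinaryWords.not_countable_gapWords
  refine ⟨fun c hc => ?_, key, hunc, fun h => hunc (h.mono ?_)⟩
  · obtain ⟨s, -, hs⟩ := BinaryWords.mem_overlapCodes_iff.1 hc
    obtain ⟨w, hw⟩ := hs.exists_isCodedBy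
    exact ⟨w, hw, fun w' hw' => hw'.unique hw⟩
  · rintro w ⟨c, hc, hw⟩
    exact key c hc w hw
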